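/- Let $R$ be a commutative ring and let $\mathcal P=\{\mathcal P(n)\}_{n\ge 1}$ be a symmetric operad in $R$-modules, with unit $\mathrm{id}\in\mathcal P(1)$, composition maps $\gamma(g;f_1,\dots,f_k)$ and right actions $x\mapsto x^{\sigma}$ of the symmetric groups $S_n$ on $\mathcal P(n)$. Let $H(\mathcal P)=\{\mathrm{id}\}\times\prod_{n\ge 2}\mathcal P(n)$ be the set of sequences $f=(f_n)_{n\ge1}$, $f_n\in\mathcal P(n)$, with $f_1=\mathrm{id}$, and define the product of $g,f\in H(\mathcal P)$ by $$(g\bullet f)_n=\sum_{\pi}\gamma\bigl(g_k;f_{j_1},\dots,f_{j_k}\bigr)^{\sigma_\pi}.$$ Here $\pi$ runs over all partitions of $\{1,\dots,n\}$ into nonempty blocks $\{i_{1,1}<\dots<i_{1,j_1}\},\dots,\{i_{k,1}<\dots<i_{k,j_k}\}$, the blocks being numbered so that their minimal elements increase, $i_{1,1}<i_{2,1}<\dots<i_{k,1}$. The permutation $\sigma_\pi$ relabels the inputs so that the $s$-th input of $\gamma(g_k;f_{j_1},\dots,f_{j_k})$ becomes the input labelled by the $s$-th entry of the list $i_{1,1},\dots,i_{1,j_1},\dots,i_{k,1},\dots,i_{k,j_k}$.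 Then $H(\mathcal P)$ is a group under $\bullet$, and for every integer $m>0$ the set $$H_m(\mathcal P)=\{f\in H(\mathcal P)\mid f_2=\dots=f_m=0\}$$ (so that $H_1(\mathcal P)=H(\mathcal P)$) is a normal subgroup of $H(\mathcal P)$. -/

import Mathlib

universe u v

/-- The identification of pairs `(i, a)` (the `a`-th input of the `i`-th factor) with the inputs
`0, …, n - 1` of a composite, in lexicographic order. -/
def operadSlot {k n : ℕ+} {j : Fin k → ℕ+} (h : ∑ i, (j i : ℕ) = n) :
    (Σ i : Fin k, Fin (j i)) ≃ Fin n :=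
  finSigmaFinEquiv.trans (finCongr h)

/-- A (linear) symmetric operad `P = {P(n)}_{n ≥ 1}` over the commutative ring `R`, with
composition maps `γ(g; f₁, …, f_k)`.  To avoid casts between the types `P(n)`, the composition
takes its output arity `n` together with a proof of `j₁ + ⋯ + j_k = n`. -/
structure SymmetricOperad (R : Type u) [CommRing R] where
  /-- The space `P(n)` of operations with `n` inputs. -/
  obj : ℕ+ → Type v
  [addCommGroup : ∀ n, AddCommGroup (obj n)]
  [module : ∀ n, Module R (obj n)]
  /-- The right action of `S_n` on `P(n)`.  The `a`-th input of `x^σ` is the `σ(a)`-th input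
  of `x`; in the endomorphism operad, `(x^σ)(v) = x(v ∘ σ⁻¹)`. -/
  act : ∀ {n : ℕ+}, Equiv.Perm (Fin n) → obj n →ₗ[R] obj n
  act_one : ∀ {n : ℕ+} (x : obj n), act 1 x = x
  act_mul : ∀ {n : ℕ+} (σ τ : Equiv.Perm (Fin n)) (x : obj n), act (σ * τ) x = act τ (act σ x)
  /-- The operadic unit. -/
  id : obj 1
  /-- The composition `γ(g; f₁, …, f_k)`, multilinear in all its arguments. -/
  comp : ∀ {k n : ℕ+} (j : Fin k → ℕ+), ∑ i, (j i : ℕ) = n →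
    (obj k →ₗ[R] MultilinearMap R (fun i : Fin k => obj (j i)) (obj n))
  id_comp : ∀ {n : ℕ+} (h : ∑ _i : Fin (1 : ℕ+), (n : ℕ) = n) (f : obj n),
    comp (fun _ => n) h id (fun _ => f) = f
  comp_id : ∀ {n : ℕ+} (h : ∑ _i : Fin n, ((1 : ℕ+) : ℕ) = n) (g : obj n),
    comp (fun _ => 1) h g (fun _ => id) = g
  /-- Associativity: `γ(γ(p; g₁, …, g_k); f₁, …, f_n)` is the composite of `p` with the
  `γ(g_i; f_{i,1}, …, f_{i,j_i})`, where the `f`'s are distributed in lexicographic order. -/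
  comp_assoc : ∀ {k n N : ℕ+} (j : Fin k → ℕ+) (hj : ∑ i, (j i : ℕ) = n)
    (l : Fin n → ℕ+) (hl : ∑ b, (l b : ℕ) = N)
    (m : Fin k → ℕ+) (hlm : ∀ i, ∑ a : Fin (j i), (l (operadSlot hj ⟨i, a⟩) : ℕ) = m i)
    (hm : ∑ i, (m i : ℕ) = N)
    (p : obj k) (g : ∀ i, obj (j i)) (f : ∀ b, obj (l b)),
    comp l hl (comp j hj p g) f =
      comp m hm p (fun i => comp (fun a : Fin (j i) => l (operadSlot hj ⟨i, a⟩)) (hlm i) (g i)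
        (fun a => f (operadSlot hj ⟨i, a⟩)))
  /-- Equivariance in the inner arguments: `γ(g; f₁^{τ₁}, …, f_k^{τ_k})` is
  `γ(g; f₁, …, f_k)` acted on by the block sum of the `τ_i`. -/
  comp_act_inner : ∀ {k n : ℕ+} (j : Fin k → ℕ+) (hj : ∑ i, (j i : ℕ) = n)
    (τ : ∀ i, Equiv.Perm (Fin (j i))) (g : obj k) (f : ∀ i, obj (j i)),
    comp j hj g (fun i => act (τ i) (f i)) =
      act ((operadSlot hj).symm.trans ((Equiv.sigmaCongrRight τ).trans (operadSlot hj)))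
        (comp j hj g f)
  /-- Equivariance in the outer argument: `γ(g^σ; f_{σ(1)}, …, f_{σ(k)})` is
  `γ(g; f₁, …, f_k)` acted on by the permutation that moves the `i`-th block to the
  `σ(i)`-th one. -/
  comp_act_outer : ∀ {k n : ℕ+} (j : Fin k → ℕ+) (hj : ∑ i, (j i : ℕ) = n)
    (σ : Equiv.Perm (Fin k)) (hσ : ∑ i, (j (σ i) : ℕ) = n) (g : obj k) (f : ∀ i, obj (j i)),
    comp (fun i => j (σ i)) hσ (act σ g) (fun i => f (σ i)) =
      act ((operadSlot hσ).symm.trans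
        ((Equiv.sigmaCongrLeft (β := fun i => Fin (j i)) σ).trans (operadSlot hj)))
        (comp j hj g f)

attribute [instance] SymmetricOperad.addCommGroup SymmetricOperad.module

/-! ### Set partitions of `{0, …, n - 1}` in canonical order

The elements of each block are listed in increasing order, and the blocks in the order of
their minimal elements. -/

namespace SetPartition

/-- The elements that are minimal in their block. -/
def minima {n : ℕ} (π : Finpartition (Finset.univ : Finset (Fin n))) : Finset (Fin n) :=
  Finset.univ.filter fun x => ∀ y ∈ π.part x, x ≤ y

theorem card_minima {n : ℕ} (π : Finpartition (Finset.univ : Finset (Fin n))) :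
    (minima π).card = π.parts.card := by
  refine Finset.card_bij (fun x _ => π.part x) ?_ ?_ ?_
  · intro x _
    exact π.part_mem.2 (Finset.mem_univ x)
  · intro x hx y hy hxy
    simp only [minima, Finset.mem_filter, Finset.mem_univ, true_and] at hx hy
    apply le_antisymm
    · exact hx y (by rw [hxy]; exact π.mem_part (Finset.mem_univ y))
    · exact hy x (by rw [← hxy]; exact π.mem_part (Finset.mem_univ x))
  · intro B hB
    have hne := π.nonempty_of_mem_parts hB
    have hB' : π.part (B.min' hne) = B := π.part_eq_of_mem hB (B.min'_mem hne)
    refine ⟨B.min' hne, ?_, hB'⟩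
    simp only [minima, Finset.mem_filter, Finset.mem_univ, true_and, hB']
    exact fun y hy => B.min'_le y hy

/-- The number `k = |π|` of blocks. -/
def numBlocks {n : ℕ+} (π : Finpartition (Finset.univ : Finset (Fin n))) : ℕ+ :=
  ⟨π.parts.card, Finset.card_pos.2
    (π.parts_nonempty (Finset.univ_nonempty (α := Fin n)).ne_empty)⟩

/-- The `ℓ`-th block in canonical order. -/
def block {n : ℕ+} (π : Finpartition (Finset.univ : Finset (Fin n))) (l : Fin (numBlocks π)) :
    Finset (Fin n) :=
  π.part ((minima π).orderEmbOfFin (card_minima π) l)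

/-- The size `j_ℓ` of the `ℓ`-th block. -/
def blockSize {n : ℕ+} (π : Finpartition (Finset.univ : Finset (Fin n)))
    (l : Fin (numBlocks π)) : ℕ+ :=
  ⟨(block π l).card, Finset.card_pos.2 (π.part_nonempty.2 (Finset.mem_univ _))⟩

/-- The `a`-th element `i_{ℓ,a}`, in increasing order, of the `ℓ`-th block. -/
def entry {n : ℕ+} (π : Finpartition (Finset.univ : Finset (Fin n)))
    (p : Σ l : Fin (numBlocks π), Fin (blockSize π l)) : Fin n :=
  (block π p.1).orderEmbOfFin rfl p.2

theorem entry_mem {n : ℕ+} (π : Finpartition (Finset.univ : Finset (Fin n)))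
    (p : Σ l : Fin (numBlocks π), Fin (blockSize π l)) : entry π p ∈ block π p.1 :=
  Finset.orderEmbOfFin_mem _ _ _

theorem block_injective {n : ℕ+} (π : Finpartition (Finset.univ : Finset (Fin n))) :
    Function.Injective (block π) := by
  intro l l' h
  apply ((minima π).orderEmbOfFin (card_minima π)).injective
  have hx := Finset.orderEmbOfFin_mem (minima π) (card_minima π) l
  have hy := Finset.orderEmbOfFin_mem (minima π) (card_minima π) l'
  unfold block at h
  simp only [minima, Finset.mem_filter, Finset.mem_univ, true_and] at hx hy
  apply le_antisymm
  · apply hx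
    have := π.mem_part (Finset.mem_univ ((minima π).orderEmbOfFin (card_minima π) l'))
    rwa [← h] at this
  · apply hy
    have := π.mem_part (Finset.mem_univ ((minima π).orderEmbOfFin (card_minima π) l))
    rwa [h] at this

theorem entry_bijective {n : ℕ+} (π : Finpartition (Finset.univ : Finset (Fin n))) :
    Function.Bijective (entry π) := by
  constructor
  · rintro ⟨l, a⟩ ⟨l', a'⟩ h
    have h1 := entry_mem π ⟨l, a⟩
    have h2 := entry_mem π ⟨l', a'⟩
    rw [← h] at h2
    have hl : l = l' := block_injective π
      (π.eq_of_mem_parts (π.part_mem.2 (Finset.mem_univ _)) (π.part_mem.2 (Finset.mem_univ _))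
        h1 h2)
    subst hl
    have : a = a' := ((block π l).orderEmbOfFin rfl).injective h
    rw [this]
  · intro x
    have hB : π.part x ∈ π.parts := π.part_mem.2 (Finset.mem_univ x)
    have hne := π.nonempty_of_mem_parts hB
    have hmin : π.part ((π.part x).min' hne) = π.part x :=
      π.part_eq_of_mem hB ((π.part x).min'_mem hne)
    have hmem : (π.part x).min' hne ∈ minima π := by
      simp only [minima, Finset.mem_filter, Finset.mem_univ, true_and, hmin]
      exact fun y hy => (π.part x).min'_le y hy
    have hr := Finset.range_orderEmbOfFin (minima π) (card_minima π)
    obtain ⟨l, hl⟩ : (π.part x).min' hne ∈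
        Set.range ((minima π).orderEmbOfFin (card_minima π)) := by
      rw [hr]; exact hmem
    have hb : block π l = π.part x := by
      rw [← hmin, ← hl]; rfl
    have hx : x ∈ Set.range ((block π l).orderEmbOfFin rfl) := by
      rw [Finset.range_orderEmbOfFin, hb]
      exact π.mem_part (Finset.mem_univ x)
    obtain ⟨a, ha⟩ := hx
    exact ⟨⟨l, a⟩, ha⟩

/-- The bijection `(ℓ, a) ↦ i_{ℓ,a}`. -/
noncomputable def entryEquiv {n : ℕ+} (π : Finpartition (Finset.univ : Finset (Fin n))) :
    (Σ l : Fin (numBlocks π), Fin (blockSize π l)) ≃ Fin n :=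
  Equiv.ofBijective (entry π) (entry_bijective π)

theorem sum_blockSize {n : ℕ+} (π : Finpartition (Finset.univ : Finset (Fin n))) :
    ∑ l, (blockSize π l : ℕ) = n := by
  have h := Fintype.card_congr (entryEquiv π)
  simpa [Fintype.card_sigma] using h

/-- The permutation `σ_π`, sending `i_{ℓ,a}` to the position of `(ℓ, a)` in the list
`i_{1,1}, …, i_{1,j_1}, …, i_{k,1}, …, i_{k,j_k}`; thus
`(γ(g; f₁, …, f_k)^{σ_π})(v) = g(f₁(v_{i_{1,1}}, …, v_{i_{1,j_1}}), …)` in the endomorphism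
operad. -/
noncomputable def perm {n : ℕ+} (π : Finpartition (Finset.univ : Finset (Fin n))) :
    Equiv.Perm (Fin n) :=
  (entryEquiv π).symm.trans (operadSlot (sum_blockSize π))

end SetPartition

namespace SymmetricOperad

variable {R : Type u} [CommRing R] (P : SymmetricOperad.{u, v} R)

/-- The product `(g • f)_n = ∑_π γ(g_k; f_{j_1}, …, f_{j_k})^{σ_π}` of sequences, where `π` runs
over all partitions of an `n`-element set. -/
noncomputable def seqProd (g f : ∀ n : ℕ+, P.obj n) : ∀ n : ℕ+, P.obj n := fun n =>
  ∑ π : Finpartition (Finset.univ : Finset (Fin n)),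
    P.act (SetPartition.perm π)
      (P.comp (SetPartition.blockSize π) (SetPartition.sum_blockSize π)
        (g (SetPartition.numBlocks π)) (fun l => f (SetPartition.blockSize π l)))

/-- The set `H(P) = {id} × ∏_{n ≥ 2} P(n)`. -/
def H : Type v := {f : ∀ n : ℕ+, P.obj n // f 1 = P.id}

theorem seqProd_one (g f : ∀ n : ℕ+, P.obj n) (hg : g 1 = P.id) (hf : f 1 = P.id) :
    P.seqProd g f 1 = P.id := by
  have key : ∀ (k : ℕ+) (j : Fin k → ℕ+) (h : ∑ i, (j i : ℕ) = (1 : ℕ+)),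
      P.comp j h (g k) (fun l => f (j l)) = P.id := by
    intro k j h
    have hk : k = 1 := by
      apply le_antisymm _ one_le
      rw [← PNat.coe_le_coe, ← h]
      calc (k : ℕ) = ∑ _i : Fin k, 1 := by simp
        _ ≤ _ := Finset.sum_le_sum fun i _ => (j i).pos
    subst hk
    have hj : j = fun _ => 1 := by
      funext i
      apply PNat.coe_injective
      rw [← h]
      have : Subsingleton (Fin ((1 : ℕ+) : ℕ)) := inferInstanceAs (Subsingleton (Fin 1))
      exact (Fintype.sum_subsingleton (fun i => (j i : ℕ)) i).symm
    subst hj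
    have hf' : (fun _ : Fin ((1 : ℕ+) : ℕ) => f 1) = fun _ => P.id := by rw [hf]
    simp only [hg]
    exact (congrArg _ hf').trans (P.comp_id h P.id)
  have hp : ∀ σ : Equiv.Perm (Fin ((1 : ℕ+) : ℕ)), σ = 1 := by
    have : Subsingleton (Fin ((1 : ℕ+) : ℕ)) := inferInstanceAs (Subsingleton (Fin 1))
    exact fun σ => Subsingleton.elim _ _
  have hatom : IsAtom (Finset.univ : Finset (Fin ((1 : ℕ+) : ℕ))) :=
    Finset.isAtom_singleton (0 : Fin 1)
  have hcard : Fintype.card (Finpartition (Finset.univ : Finset (Fin ((1 : ℕ+) : ℕ)))) = 1 := by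
    refine Fintype.card_eq_one_iff.2 ⟨Finpartition.indiscrete hatom.1, fun π => ?_⟩
    exact (hatom.uniqueFinpartition (P := π)).uniq _ |>.trans
      ((hatom.uniqueFinpartition (P := π)).uniq _).symm
  unfold seqProd
  simp only [key, hp, P.act_one, Finset.sum_const, Finset.card_univ, hcard, one_smul]

/-- The product `g • f` on `H(P)`. -/
noncomputable def prod (g f : P.H) : P.H :=
  ⟨P.seqProd g.1 f.1, P.seqProd_one g.1 f.1 g.2 f.2⟩

/-- The subset `H_m(P)` of all `f ∈ H(P)` with `f_2 = ⋯ = f_m = 0`. -/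
def Hm (m : ℕ) : Set P.H :=
  {f | ∀ n : ℕ+, 2 ≤ (n : ℕ) → (n : ℕ) ≤ m → f.1 n = 0}

end SymmetricOperad

/-! The product is a sum over set partitions, so associativity is a statement about chains of two
partitions. A term of `(h • g) • f` is a partition `s` together with a partition of the set of
blocks of `s`, that is, some `u ≥ s`. A term of `h • (g • f)` is a partition `u` together with a
partition of each of its blocks, that is, some `s ≤ u`. Both sides are thus sums over pairs `s ≤ u`,
and corresponding terms agree by the associativity and equivariance axioms. The delicate point is
the order of blocks and inputs: grouping the canonically listed blocks of `s` by `u` rarely gives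
consecutive groups. Terms are therefore defined for blocks listed in any order (`graft`),
associativity is proved there (`graft_graft`), and canonical order returns because it is preserved
by coarsening (`Canonical.exists_coarsening`) and determined by the partition (`Canonical.ext`). The
one-block partition shows that `(id, 0, 0, …)` is a left unit. The partition into singletons
contributes `g n` to `(g • f) n`, and every other term uses `g` in arity less than `n` only, so left
inverses are found by recursion. Finally `(g • f) n` depends only on arities at most `n`; agreement
up to arity `m` is thus a congruence, and `H_m` is the kernel of the quotient map. -/

/-! ### Positions of inputs in iterated composites -/

theorem operadSlot_val {k n : ℕ+} {j : Fin k → ℕ+} (h : ∑ i, (j i : ℕ) = n)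
    (p : Σ i : Fin k, Fin (j i)) :
    (operadSlot h p : ℕ) = ∑ i, (if i < p.1 then (j i : ℕ) else 0) + p.2 := by
  have h1 : (operadSlot h p : ℕ) = (finSigmaFinEquiv p : ℕ) := rfl
  rw [h1, finSigmaFinEquiv_apply, Nat.add_right_cancel_iff, ← Finset.sum_filter]
  refine Finset.sum_bij (fun i _ => Fin.castLE p.1.2.le i) ?_ ?_ ?_ ?_
  · intro i _
    simp only [Finset.mem_filter, Finset.mem_univ, true_and]
    exact i.2
  · intro a _ b _ hab
    exact Fin.castLE_injective _ hab
  · intro b hb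
    simp only [Finset.mem_filter, Finset.mem_univ, true_and] at hb
    exact ⟨⟨b, hb⟩, Finset.mem_univ _, rfl⟩
  · intro a _
    rfl

theorem operadSlot_lt_iff {k n : ℕ+} {j : Fin k → ℕ+} (h : ∑ i, (j i : ℕ) = n)
    (i i' : Fin k) (a : Fin (j i)) (a' : Fin (j i')) :
    operadSlot h ⟨i, a⟩ < operadSlot h ⟨i', a'⟩ ↔ i < i' ∨ i = i' ∧ (a : ℕ) < a' := by
  have key : ∀ (i i' : Fin k) (a : Fin (j i)) (a' : Fin (j i')), i < i' →
      operadSlot h ⟨i, a⟩ < operadSlot h ⟨i', a'⟩ := by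
    intro i i' a a' hi
    rw [Fin.lt_def, operadSlot_val, operadSlot_val]
    have h1 : ∑ b, (if b < i then (j b : ℕ) else 0) + j i
        ≤ ∑ b, (if b < i' then (j b : ℕ) else 0) := by
      have h2 : (j i : ℕ) = ∑ b, (if b = i then (j b : ℕ) else 0) := by simp
      rw [h2, ← Finset.sum_add_distrib]
      refine Finset.sum_le_sum fun b _ => ?_
      split_ifs with h3 h4 h5 h6 <;> omega
    have := a.2
    dsimp only
    omega
  rcases lt_trichotomy i i' with hi | hi | hi
  · simp [hi, key i i' a a' hi]
  · subst hi
    rw [Fin.lt_def, operadSlot_val, operadSlot_val]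
    simp
  · simp [hi.not_gt, hi.ne', (key i' i a' a hi).le]

/-- Nested lexicographic numbering is associative: the inputs preceding a block are those of all
earlier groups and those of the earlier blocks of the same group. -/
theorem operadSlot_operadSlot {k n N : ℕ+} (j : Fin k → ℕ+) (hj : ∑ i, (j i : ℕ) = n)
    (l : Fin n → ℕ+) (hl : ∑ b, (l b : ℕ) = N)
    (m : Fin k → ℕ+) (hlm : ∀ i, ∑ a : Fin (j i), (l (operadSlot hj ⟨i, a⟩) : ℕ) = m i)
    (hm : ∑ i, (m i : ℕ) = N) (i : Fin k) (a : Fin (j i)) (s : Fin (l (operadSlot hj ⟨i, a⟩))) :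
    operadSlot hl ⟨operadSlot hj ⟨i, a⟩, s⟩ =
      operadSlot hm ⟨i, operadSlot (hlm i) ⟨a, s⟩⟩ := by
  rw [Fin.ext_iff, operadSlot_val, operadSlot_val, operadSlot_val, ← add_assoc,
    Nat.add_right_cancel_iff]
  dsimp only
  rw [← (operadSlot hj).sum_comp, Fintype.sum_sigma]
  simp only [operadSlot_lt_iff]
  have h1 : ∀ i', ∑ a' : Fin (j i'),
      (if i' < i ∨ i' = i ∧ (a' : ℕ) < a then (l (operadSlot hj ⟨i', a'⟩) : ℕ) else 0) =
      (if i' < i then (m i' : ℕ) else 0) +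
        if i' = i then ∑ a' : Fin (j i),
          (if a' < a then (l (operadSlot hj ⟨i, a'⟩) : ℕ) else 0) else 0 := by
    intro i'
    rcases lt_trichotomy i' i with h | h | h
    · simp [h, h.ne, hlm]
    · subst h
      simp
    · simp [h.not_gt, h.ne']
  simp only [h1, Finset.sum_add_distrib, Finset.sum_ite_eq', Finset.mem_univ, if_true]

/-- A decomposition of `{0, …, n - 1}` into nonempty blocks, where the blocks and the elements
of each block are listed in some order. -/
structure Decomposition (n : ℕ+) where
  /-- The number of blocks. -/
  card : ℕ+
  /-- The sizes of the blocks. -/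
  size : Fin card → ℕ+
  /-- The `a`-th element of the `b`-th block. -/
  entry : (Σ b, Fin (size b)) ≃ Fin n

namespace Decomposition

theorem sum_size {n : ℕ+} (D : Decomposition n) : ∑ b, (D.size b : ℕ) = n := by
  have h := Fintype.card_congr D.entry
  simpa [Fintype.card_sigma] using h

/-- The partition underlying a decomposition. -/
def setoid {n : ℕ+} (D : Decomposition n) : Setoid (Fin n) :=
  Setoid.ker fun x => (D.entry.symm x).1

theorem setoid_apply {n : ℕ+} (D : Decomposition n) (x y : Fin n) :
    D.setoid x y ↔ (D.entry.symm x).1 = (D.entry.symm y).1 := Iff.rfl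

end Decomposition

/-! ### Grafting along decompositions in arbitrary order -/

namespace SymmetricOperad

variable {R : Type u} [CommRing R] (P : SymmetricOperad.{u, v} R)

/-- The composite of `x` with the `y b`, the inputs of `y b` being labelled by the `b`-th block
of the decomposition. -/
def graft {n : ℕ+} (D : Decomposition n) (x : P.obj D.card) (y : ∀ b, P.obj (D.size b)) :
    P.obj n :=
  P.act (D.entry.symm.trans (operadSlot D.sum_size)) (P.comp D.size D.sum_size x y)

/-- Outer equivariance: permuting the inputs of `x` amounts to listing the blocks in another order.
-/
theorem graft_act {k n : ℕ+} (l : Fin k → ℕ+) (σ : Equiv.Perm (Fin k))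
    (e : (Σ b, Fin (l (σ b))) ≃ Fin n) (x : P.obj k) (y : ∀ b, P.obj (l b)) :
    P.graft ⟨k, fun b => l (σ b), e⟩ (P.act σ x) (fun b => y (σ b)) =
      P.graft ⟨k, l, (Equiv.sigmaCongrLeft (β := fun b => Fin (l b)) σ).symm.trans e⟩ x y := by
  have hl : ∑ b, (l b : ℕ) = n := by
    rw [← Decomposition.sum_size ⟨k, fun b => l (σ b), e⟩]
    exact (Equiv.sum_comp σ fun b => (l b : ℕ)).symm
  unfold graft
  dsimp only
  rw [P.comp_act_outer l hl, ← P.act_mul]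
  congr 2
  ext z
  simp

/-- The case of consecutive groups of blocks, where the associativity axiom applies directly and
inner equivariance absorbs the relabellings `c i`. The sizes `L` are kept apart from `l` because
they are known in another form when this is applied. -/
theorem graft_graft_slot {m k N : ℕ+} (j : Fin m → ℕ+) (hj : ∑ i, (j i : ℕ) = k)
    (l : Fin k → ℕ+) (e : (Σ b, Fin (l b)) ≃ Fin N)
    (M : Fin m → ℕ+) (L : ∀ i, Fin (j i) → ℕ+) (hL : ∀ i a, L i a = l (operadSlot hj ⟨i, a⟩))
    (c : ∀ i, (Σ a, Fin (L i a)) ≃ Fin (M i)) (e' : (Σ i, Fin (M i)) ≃ Fin N)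
    (he : ∀ i a (s : Fin (L i a)), e' ⟨i, c i ⟨a, s⟩⟩ =
      e ⟨operadSlot hj ⟨i, a⟩, Fin.cast (congrArg _ (hL i a)) s⟩)
    (h : P.obj m) (g : ∀ i, P.obj (j i)) (f : ∀ n, P.obj n) :
    P.graft ⟨k, l, e⟩ (P.comp j hj h g) (fun b => f (l b)) =
      P.graft ⟨m, M, e'⟩ h (fun i => P.graft ⟨j i, L i, c i⟩ (g i) (fun a => f (L i a))) := by
  obtain rfl : L = fun i a => l (operadSlot hj ⟨i, a⟩) := funext fun i => funext (hL i)
  have hlm : ∀ i, ∑ a : Fin (j i), (l (operadSlot hj ⟨i, a⟩) : ℕ) = M i := fun i =>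
    Decomposition.sum_size ⟨j i, fun a => l (operadSlot hj ⟨i, a⟩), c i⟩
  have hl : ∑ b, (l b : ℕ) = N := Decomposition.sum_size ⟨k, l, e⟩
  have hM : ∑ i, (M i : ℕ) = N := Decomposition.sum_size ⟨m, M, e'⟩
  unfold graft
  dsimp only
  rw [P.comp_assoc j hj l hl M hlm hM, P.comp_act_inner, ← P.act_mul]
  congr 2
  ext z
  obtain ⟨⟨i, q⟩, rfl⟩ := e'.surjective z
  obtain ⟨⟨a, s⟩, rfl⟩ := (c i).surjective q
  have h1 : e.symm (e' ⟨i, c i ⟨a, s⟩⟩) = ⟨operadSlot hj ⟨i, a⟩, s⟩ := by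
    rw [he, Equiv.symm_apply_apply]
    rfl
  simp only [Equiv.trans_apply, Equiv.Perm.mul_apply, Equiv.symm_apply_apply, h1,
    Equiv.sigmaCongrRight_apply]
  rw [operadSlot_operadSlot j hj l hl M hlm hM]

/-- Associativity of grafting: composing along a decomposition of `{0, …, N - 1}` and then along
a decomposition of its set of blocks is composing along the coarser decomposition of
`{0, …, N - 1}` and along the decompositions induced on its blocks. -/
theorem graft_graft {N : ℕ+} (D : Decomposition N) (E : Decomposition D.card)
    (M : Fin E.card → ℕ+)
    (c : ∀ i, (Σ a, Fin (D.size (E.entry ⟨i, a⟩))) ≃ Fin (M i)) (e : (Σ i, Fin (M i)) ≃ Fin N)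
    (he : ∀ i a s, e ⟨i, c i ⟨a, s⟩⟩ = D.entry ⟨E.entry ⟨i, a⟩, s⟩)
    (h : P.obj E.card) (g : ∀ i, P.obj (E.size i)) (f : ∀ n, P.obj n) :
    P.graft D (P.graft E h g) (fun b => f (D.size b)) =
      P.graft ⟨E.card, M, e⟩ h (fun i => P.graft ⟨E.size i, fun a => D.size (E.entry ⟨i, a⟩), c i⟩
        (g i) (fun a => f (D.size (E.entry ⟨i, a⟩)))) := by
  obtain ⟨k, l, d⟩ := D
  obtain ⟨m, j, t⟩ := E
  dsimp only at *
  have hj : ∑ i, (j i : ℕ) = k := Decomposition.sum_size ⟨m, j, t⟩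
  obtain ⟨σ, hσ, ht⟩ : ∃ σ : Equiv.Perm (Fin k), σ = t.symm.trans (operadSlot hj) ∧
      P.graft ⟨m, j, t⟩ h g = P.act σ (P.comp j hj h g) := ⟨_, rfl, rfl⟩
  -- Relisting the blocks by `σ` makes the groups consecutive, which reduces to `graft_graft_slot`.
  obtain ⟨l', rfl⟩ : ∃ l' : Fin k → ℕ+, l = fun b => l' (σ b) :=
    ⟨fun b => l (σ.symm b), by simp⟩
  rw [ht, P.graft_act l' σ d (P.comp j hj h g) (fun b => f (l' b))]
  have hσt : ∀ i a, σ (t ⟨i, a⟩) = operadSlot hj ⟨i, a⟩ := by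
    intro i a
    simp [hσ]
  apply P.graft_graft_slot j hj l' _ M (fun i a => l' (σ (t ⟨i, a⟩)))
    (fun i a => by rw [hσt]) c e
  intro i a s
  rw [he, Equiv.trans_apply]
  congr 1
  rw [Equiv.eq_symm_apply]
  have h2 : ∀ (b : Fin k) (hb : σ (t ⟨i, a⟩) = b) (hs : (l' (σ (t ⟨i, a⟩)) : ℕ) = l' b),
      (⟨σ (t ⟨i, a⟩), s⟩ : Σ b, Fin (l' b)) = ⟨b, Fin.cast hs s⟩ := by
    rintro b rfl hs
    rfl
  exact h2 _ (hσt i a) _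

end SymmetricOperad

/-! ### Canonical decompositions and set partitions -/

namespace Decomposition

/-- A decomposition is canonical if each block is listed in increasing order and the blocks are
listed in the order of their minimal elements. -/
structure Canonical {n : ℕ+} (D : Decomposition n) : Prop where
  strictMono_entry : ∀ b, StrictMono fun a => D.entry ⟨b, a⟩
  strictMono_zero : StrictMono fun b => D.entry ⟨b, 0⟩

variable {n : ℕ+}

theorem setoid_entry (D : Decomposition n) (p q : Σ b, Fin (D.size b)) :
    D.setoid (D.entry p) (D.entry q) ↔ p.1 = q.1 := by
  simp [setoid_apply]

theorem Canonical.zero_le {D : Decomposition n} (hD : D.Canonical) (b : Fin D.card)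
    (a : Fin (D.size b)) : D.entry ⟨b, 0⟩ ≤ D.entry ⟨b, a⟩ :=
  (hD.strictMono_entry b).monotone (Fin.zero_le a)

theorem Canonical.range_zero {D : Decomposition n} (hD : D.Canonical) :
    Set.range (fun b => D.entry ⟨b, 0⟩) = {x | ∀ y, D.setoid x y → x ≤ y} := by
  ext x
  constructor
  · rintro ⟨b, rfl⟩ y hy
    obtain ⟨⟨b', a⟩, rfl⟩ := D.entry.surjective y
    obtain rfl : b = b' := (D.setoid_entry _ _).1 hy
    exact hD.zero_le b a
  · intro hx
    obtain ⟨⟨b, a⟩, rfl⟩ := D.entry.surjective x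
    exact ⟨b, le_antisymm (hD.zero_le b a) (hx _ ((D.setoid_entry _ _).2 rfl))⟩

theorem range_entry (D : Decomposition n) (b : Fin D.card) :
    Set.range (fun a => D.entry ⟨b, a⟩) = {x | D.setoid (D.entry ⟨b, 0⟩) x} := by
  ext x
  constructor
  · rintro ⟨a, rfl⟩
    exact (D.setoid_entry _ _).2 rfl
  · intro hx
    obtain ⟨⟨b', a⟩, rfl⟩ := D.entry.surjective x
    obtain rfl : b = b' := (D.setoid_entry _ _).1 hx
    exact ⟨a, rfl⟩

theorem eq_of_range_eq {α : Type*} {k k' : ℕ+} {f : Fin k → α} {g : Fin k' → α}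
    (hf : Function.Injective f) (hg : Function.Injective g)
    (h : Set.range f = Set.range g) : k = k' := by
  have h1 : Nat.card (Set.range f) = k := by
    rw [Nat.card_congr (Equiv.ofInjective f hf).symm, Nat.card_fin]
  have h2 : Nat.card (Set.range g) = k' := by
    rw [Nat.card_congr (Equiv.ofInjective g hg).symm, Nat.card_fin]
  apply PNat.coe_injective
  rw [← h1, ← h2, h]

/-- A strictly monotone map on `Fin k` is determined by its range. This applies first to the block
minima, whose set depends only on the partition, and then to each block. -/
theorem Canonical.ext {D E : Decomposition n} (hD : D.Canonical) (hE : E.Canonical)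
    (h : D.setoid = E.setoid) : D = E := by
  have hz : Set.range (fun b => D.entry ⟨b, 0⟩) = Set.range (fun b => E.entry ⟨b, 0⟩) := by
    rw [hD.range_zero, hE.range_zero, h]
  have hr := D.range_entry
  have hr' := E.range_entry
  rw [← h] at hr'
  obtain ⟨k, j, e⟩ := D
  obtain ⟨k', j', e'⟩ := E
  have hD0 := hD.strictMono_zero
  have hE0 := hE.strictMono_zero
  have hD1 := hD.strictMono_entry
  have hE1 := hE.strictMono_entry
  dsimp only at *
  obtain rfl : k = k' := eq_of_range_eq hD0.injective hE0.injective hz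
  have h0 := congrFun ((hD0.range_inj hE0).1 hz)
  have hre : ∀ b, Set.range (fun a => e ⟨b, a⟩) = Set.range (fun a => e' ⟨b, a⟩) := by
    intro b
    rw [hr, hr', h0]
  obtain rfl : j = j' := funext fun b =>
    eq_of_range_eq (hD1 b).injective (hE1 b).injective (hre b)
  obtain rfl : e = e' := by
    ext1 ⟨b, a⟩
    exact congrFun (((hD1 b).range_inj (hE1 b)).1 (hre b)) a
  rfl

/-- The canonical decomposition given by a partition. -/
noncomputable def ofFinpartition (π : Finpartition (Finset.univ : Finset (Fin n))) :
    Decomposition n :=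
  ⟨SetPartition.numBlocks π, SetPartition.blockSize π, SetPartition.entryEquiv π⟩

theorem setoid_ofFinpartition (π : Finpartition (Finset.univ : Finset (Fin n))) (x y : Fin n) :
    (ofFinpartition π).setoid x y ↔ π.part x = π.part y := by
  have hb : ∀ p : Σ b, Fin (SetPartition.blockSize π b),
      π.part (SetPartition.entry π p) = SetPartition.block π p.1 := fun p =>
    π.part_eq_of_mem (π.part_mem.2 (Finset.mem_univ _)) (SetPartition.entry_mem π p)
  obtain ⟨p, rfl⟩ := (ofFinpartition π).entry.surjective x
  obtain ⟨q, rfl⟩ := (ofFinpartition π).entry.surjective y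
  rw [setoid_entry]
  refine (SetPartition.block_injective π).eq_iff.symm.trans ?_
  exact iff_of_eq (congrArg₂ _ (hb p).symm (hb q).symm)

theorem canonical_ofFinpartition (π : Finpartition (Finset.univ : Finset (Fin n))) :
    (ofFinpartition π).Canonical := by
  have h1 : ∀ b : Fin (SetPartition.numBlocks π),
      StrictMono fun a : Fin (SetPartition.blockSize π b) => SetPartition.entry π ⟨b, a⟩ := fun b =>
    ((SetPartition.block π b).orderEmbOfFin rfl).strictMono
  refine ⟨h1, ?_⟩
  have h2 : ∀ b : Fin (SetPartition.numBlocks π), SetPartition.entry π ⟨b, 0⟩ =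
      (SetPartition.minima π).orderEmbOfFin (SetPartition.card_minima π) b := by
    intro b
    have hx := Finset.orderEmbOfFin_mem (SetPartition.minima π) (SetPartition.card_minima π) b
    have hmem := π.mem_part
      (Finset.mem_univ ((SetPartition.minima π).orderEmbOfFin (SetPartition.card_minima π) b))
    simp only [SetPartition.minima, Finset.mem_filter, Finset.mem_univ, true_and] at hx
    apply le_antisymm
    · have hr := Finset.range_orderEmbOfFin (SetPartition.block π b) rfl
      rw [Set.ext_iff] at hr
      obtain ⟨a, ha⟩ := (hr _).2 hmem
      exact le_of_le_of_eq ((h1 b).monotone (Fin.zero_le (n := SetPartition.blockSize π b) a)) ha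
    · exact hx _ (SetPartition.entry_mem π ⟨b, 0⟩)
  intro b b' hb
  exact lt_of_eq_of_lt (h2 b) (lt_of_lt_of_eq ((OrderEmbedding.strictMono _) hb) (h2 b').symm)

theorem setoid_ofFinpartition_bijective :
    Function.Bijective fun π : Finpartition (Finset.univ : Finset (Fin n)) =>
      (ofFinpartition π).setoid := by
  classical
  constructor
  · intro π π' h
    have h1 : ∀ x, π.part x = π'.part x := by
      intro x
      ext y
      have h2 := setoid_ofFinpartition π x y
      have h3 := setoid_ofFinpartition π' x y
      dsimp only at h
      rw [h] at h2
      rw [π.mem_part_iff_part_eq_part (Finset.mem_univ _) (Finset.mem_univ _),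
        π'.mem_part_iff_part_eq_part (Finset.mem_univ _) (Finset.mem_univ _), eq_comm, ← h2, h3,
        eq_comm]
    ext B
    constructor
    · intro hB
      obtain ⟨x, hx⟩ := π.nonempty_of_mem_parts hB
      rw [← π.part_eq_of_mem hB hx, h1]
      exact π'.part_mem.2 (Finset.mem_univ _)
    · intro hB
      obtain ⟨x, hx⟩ := π'.nonempty_of_mem_parts hB
      rw [← π'.part_eq_of_mem hB hx, ← h1]
      exact π.part_mem.2 (Finset.mem_univ _)
  · intro s
    refine ⟨Finpartition.ofSetoid s, ?_⟩
    ext x y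
    rw [setoid_ofFinpartition, ← Finpartition.mem_part_ofSetoid_iff_rel,
      Finpartition.mem_part_iff_part_eq_part _ (Finset.mem_univ _) (Finset.mem_univ _), eq_comm]

end Decomposition

noncomputable instance {α : Type*} [Finite α] : Fintype (Setoid α) :=
  haveI : Finite (Setoid α) := Finite.of_injective (fun s : Setoid α => s.r)
    fun _ _ h => Setoid.ext fun x y => iff_of_eq (congrFun (congrFun h x) y)
  Fintype.ofFinite _

namespace Decomposition

variable {n : ℕ+}

theorem exists_canonical (s : Setoid (Fin n)) :
    ∃ D : Decomposition n, D.Canonical ∧ D.setoid = s := by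
  obtain ⟨π, hπ⟩ := setoid_ofFinpartition_bijective.2 s
  exact ⟨ofFinpartition π, canonical_ofFinpartition π, hπ⟩

/-- The canonical decomposition with a given underlying partition. -/
noncomputable def canon (s : Setoid (Fin n)) : Decomposition n :=
  (exists_canonical s).choose

theorem canonical_canon (s : Setoid (Fin n)) : (canon s).Canonical :=
  (exists_canonical s).choose_spec.1

theorem setoid_canon (s : Setoid (Fin n)) : (canon s).setoid = s :=
  (exists_canonical s).choose_spec.2

theorem Canonical.canon_eq {D : Decomposition n} (hD : D.Canonical) {s : Setoid (Fin n)}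
    (hs : D.setoid = s) : canon s = D :=
  (canonical_canon s).ext hD ((setoid_canon s).trans hs.symm)

end Decomposition

/-! ### The product as a sum over equivalence relations -/

namespace SymmetricOperad

variable {R : Type u} [CommRing R] (P : SymmetricOperad.{u, v} R)

theorem seqProd_eq_sum (g f : ∀ n : ℕ+, P.obj n) (n : ℕ+) :
    P.seqProd g f n = ∑ s : Setoid (Fin n), P.graft (Decomposition.canon s)
      (g (Decomposition.canon s).card) (fun b => f ((Decomposition.canon s).size b)) := by
  refine Fintype.sum_bijective _ Decomposition.setoid_ofFinpartition_bijective _ _ fun π => ?_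
  rw [(Decomposition.canonical_ofFinpartition π).canon_eq rfl]
  rfl

end SymmetricOperad

/-! ### Coarsening and refinement -/

theorem exists_equiv_fin_strictMono {X α : Type*} [Fintype X] [Nonempty X] [LinearOrder α]
    {f : X → α} (hf : Function.Injective f) :
    ∃ (M : ℕ+) (c : X ≃ Fin M), StrictMono fun q => f (c.symm q) := by
  let _ : LinearOrder X := LinearOrder.lift' f hf
  refine ⟨⟨Fintype.card X, Fintype.card_pos⟩,
    (Fintype.orderIsoFinOfCardEq X rfl).symm.toEquiv, fun p q hpq => ?_⟩
  exact (Fintype.orderIsoFinOfCardEq X rfl).strictMono hpq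

namespace Decomposition

variable {N : ℕ+}

/-- Merge the blocks of `D` grouped by `E` and sort each union. Its least element is the minimum of
the first block in the group, so the unions are again ordered by their minima, and each union
inherits a canonical decomposition into blocks of `D`. -/
theorem Canonical.exists_coarsening {D : Decomposition N} (hD : D.Canonical)
    {E : Decomposition D.card} (hE : E.Canonical) :
    ∃ (M : Fin E.card → ℕ+) (c : ∀ i, (Σ a, Fin (D.size (E.entry ⟨i, a⟩))) ≃ Fin (M i))
      (e : (Σ i, Fin (M i)) ≃ Fin N),
      (∀ i a s, e ⟨i, c i ⟨a, s⟩⟩ = D.entry ⟨E.entry ⟨i, a⟩, s⟩) ∧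
      (⟨E.card, M, e⟩ : Decomposition N).Canonical ∧
      ∀ i, (⟨E.size i, fun a => D.size (E.entry ⟨i, a⟩), c i⟩ : Decomposition (M i)).Canonical := by
  have hinj : ∀ i, Function.Injective fun p : Σ a, Fin (D.size (E.entry ⟨i, a⟩)) =>
      D.entry ⟨E.entry ⟨i, p.1⟩, p.2⟩ := by
    rintro i ⟨a, s⟩ ⟨a', s'⟩ h
    have h1 := D.entry.injective h
    have h2 := E.entry.injective (congrArg Sigma.fst h1)
    obtain rfl : a = a' := by simpa using h2
    obtain rfl : s = s' := by simpa using h1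
    rfl
  -- `c i` numbers the inputs of the `i`-th union by increasing label.
  choose M c hc using fun i => exists_equiv_fin_strictMono (hinj i)
  let e0 : (Σ i, Σ a : Fin (E.size i), Fin (D.size (E.entry ⟨i, a⟩))) ≃ Fin N :=
    ((Equiv.sigmaAssoc fun (i : Fin E.card) (a : Fin (E.size i)) =>
      Fin (D.size (E.entry ⟨i, a⟩))).symm.trans
      (Equiv.sigmaCongrLeft (β := fun b => Fin (D.size b)) E.entry)).trans D.entry
  have he0 : ∀ i a s, e0 ⟨i, a, s⟩ = D.entry ⟨E.entry ⟨i, a⟩, s⟩ := fun i a s => rfl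
  obtain ⟨e, he⟩ : ∃ e : (Σ i, Fin (M i)) ≃ Fin N,
      ∀ i a s, e ⟨i, c i ⟨a, s⟩⟩ = D.entry ⟨E.entry ⟨i, a⟩, s⟩ := by
    refine ⟨(Equiv.sigmaCongrRight c).symm.trans e0, fun i a s => ?_⟩
    rw [← he0, Equiv.trans_apply]
    congr 1
    rw [Equiv.symm_apply_eq]
    rfl
  have hmono : ∀ i, StrictMono fun q => e ⟨i, q⟩ := by
    intro i p q hpq
    have h1 := hc i hpq
    dsimp only at h1 ⊢
    rwa [← he, ← he, Sigma.eta, Sigma.eta, Equiv.apply_symm_apply, Equiv.apply_symm_apply] at h1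
  have hzero : ∀ i, e ⟨i, 0⟩ = D.entry ⟨E.entry ⟨i, 0⟩, 0⟩ := by
    intro i
    apply le_antisymm
    · rw [← he]
      exact (hmono i).monotone (Fin.zero_le _)
    · obtain ⟨⟨a, s⟩, h⟩ := (c i).surjective 0
      rw [← h, he]
      exact (hD.strictMono_zero.monotone ((hE.strictMono_entry i).monotone
        (Fin.zero_le a))).trans (hD.zero_le _ s)
  refine ⟨M, c, e, he, ⟨hmono, ?_⟩, fun i => ⟨?_, ?_⟩⟩
  · intro i i' hi
    dsimp only
    rw [hzero, hzero]
    exact hD.strictMono_zero (hE.strictMono_zero hi)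
  -- Order inside a union can be tested on labels, since `e ⟨i, ·⟩` is strictly monotone.
  · intro a s s' hs
    refine (hmono i).lt_iff_lt.1 ?_
    dsimp only
    rw [he, he]
    exact hD.strictMono_entry _ hs
  · intro a a' ha
    refine (hmono i).lt_iff_lt.1 ?_
    dsimp only
    rw [he, he]
    exact hD.strictMono_zero (hE.strictMono_entry i ha)

/-- The refinement of the partition underlying `D` by partitions of its blocks. -/
def refinement (D : Decomposition N) (w : ∀ i, Setoid (Fin (D.size i))) : Setoid (Fin N) :=
  Setoid.ker fun x =>
    (⟨(D.entry.symm x).1, Quotient.mk (w _) (D.entry.symm x).2⟩ : Σ i, Quotient (w i))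

theorem refinement_le (D : Decomposition N) (w : ∀ i, Setoid (Fin (D.size i))) :
    D.refinement w ≤ D.setoid := by
  intro x y hxy
  have h : (⟨(D.entry.symm x).1, Quotient.mk (w _) (D.entry.symm x).2⟩ : Σ i, Quotient (w i)) =
    ⟨(D.entry.symm y).1, Quotient.mk (w _) (D.entry.symm y).2⟩ := hxy
  exact (Sigma.mk.inj h).1

theorem refinement_entry (D : Decomposition N) (w : ∀ i, Setoid (Fin (D.size i)))
    (i : Fin D.card) (a a' : Fin (D.size i)) :
    D.refinement w (D.entry ⟨i, a⟩) (D.entry ⟨i, a'⟩) ↔ w i a a' := by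
  rw [refinement, Setoid.ker_def, Equiv.symm_apply_apply, Equiv.symm_apply_apply]
  constructor
  · intro h
    exact Quotient.exact (eq_of_heq (Sigma.mk.inj h).2)
  · intro h
    rw [Quotient.sound (s := w i) h]

end Decomposition

/-! ### Associativity of the product -/

namespace SymmetricOperad

open Decomposition

variable {R : Type u} [CommRing R] (P : SymmetricOperad.{u, v} R)

/-- The termwise identity for a pair `s ≤ u`: `t` is the partition that `u` induces on the blocks of
`s`, and `w i` is the restriction of `s` to the `i`-th block of `u`. -/
theorem graft_canon_graft_canon {N : ℕ+} {s u : Setoid (Fin N)} (hsu : s ≤ u)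
    (t : Setoid (Fin (canon s).card)) (ht : t = u.comap fun b => (canon s).entry ⟨b, 0⟩)
    (w : ∀ i, Setoid (Fin ((canon u).size i)))
    (hw : ∀ i, w i = s.comap fun q => (canon u).entry ⟨i, q⟩)
    (h g f : ∀ n, P.obj n) :
    P.graft (canon s) (P.graft (canon t) (h _) (fun i => g ((canon t).size i)))
        (fun b => f ((canon s).size b)) =
      P.graft (canon u) (h _) (fun i => P.graft (canon (w i)) (g _)
        (fun b => f ((canon (w i)).size b))) := by
  have hD := canonical_canon s
  have hDs := setoid_canon s
  -- Only canonicity and the underlying partition are used from here on; forgetting the choice lets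
  -- dependent types be rewritten by substitution.
  generalize canon s = D at *
  have hE := canonical_canon t
  have hEt := setoid_canon t
  generalize canon t = E at *
  obtain ⟨M, c, e, he, heC, hcC⟩ := hD.exists_coarsening hE
  rw [P.graft_graft D E M c e he]
  have heu : (⟨E.card, M, e⟩ : Decomposition N).setoid = u := by
    ext x y
    obtain ⟨⟨i, p⟩, rfl⟩ := e.surjective x
    obtain ⟨⟨i', p'⟩, rfl⟩ := e.surjective y
    obtain ⟨⟨a, r⟩, rfl⟩ := (c i).surjective p
    obtain ⟨⟨a', r'⟩, rfl⟩ := (c i').surjective p'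
    refine (setoid_entry ⟨E.card, M, e⟩ _ _).trans ?_
    dsimp only
    have h0 : ∀ b q, u (D.entry ⟨b, q⟩) (D.entry ⟨b, 0⟩) := fun b q => hsu (by
      rw [← hDs, setoid_entry])
    have h1 := E.setoid_entry ⟨i, a⟩ ⟨i', a'⟩
    rw [hEt, ht, Setoid.comap_rel] at h1
    rw [he, he]
    rw [← h1]
    exact ⟨fun h2 => u.trans (h0 _ _) (u.trans h2 (u.symm (h0 _ _))),
      fun h2 => u.trans (u.symm (h0 _ _)) (u.trans h2 (h0 _ _))⟩
  have hu := heC.canon_eq heu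
  generalize canon u = U at *
  subst hu
  congr 1
  funext i
  have hwi : (⟨E.size i, fun a => D.size (E.entry ⟨i, a⟩), c i⟩ : Decomposition (M i)).setoid
      = w i := by
    ext x y
    obtain ⟨⟨a, r⟩, rfl⟩ := (c i).surjective x
    obtain ⟨⟨a', r'⟩, rfl⟩ := (c i).surjective y
    refine (setoid_entry ⟨E.size i, fun a => D.size (E.entry ⟨i, a⟩), c i⟩ _ _).trans ?_
    rw [hw, Setoid.comap_rel, he, he, ← hDs, setoid_entry]
    simp
  have h2 := (hcC i).canon_eq hwi
  dsimp only at *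
  rw [h2]

theorem graft_sum_left {n : ℕ+} (D : Decomposition n) {ι : Type*} (t : Finset ι)
    (x : ι → P.obj D.card) (y : ∀ b, P.obj (D.size b)) :
    P.graft D (∑ i ∈ t, x i) y = ∑ i ∈ t, P.graft D (x i) y := by
  simp [graft]

theorem graft_sum_right {n : ℕ+} (D : Decomposition n) {ι : Fin D.card → Type*}
    [∀ b, Fintype (ι b)] (x : P.obj D.card) (y : ∀ b, ι b → P.obj (D.size b)) :
    P.graft D x (fun b => ∑ i, y b i) = ∑ r : ∀ b, ι b, P.graft D x (fun b => y b (r b)) := by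
  simp [graft, MultilinearMap.map_sum]

theorem seqProd_assoc (h g f : ∀ n, P.obj n) :
    P.seqProd (P.seqProd h g) f = P.seqProd h (P.seqProd g f) := by
  classical
  funext N
  rw [seqProd_eq_sum, seqProd_eq_sum]
  simp only [seqProd_eq_sum, graft_sum_left]
  -- By multilinearity the inner sums become one sum over families of partitions of the blocks of
  -- `u`.
  have hR : ∀ u : Setoid (Fin N), P.graft (canon u) (h _) (fun i =>
      ∑ w : Setoid (Fin ((canon u).size i)), P.graft (canon w) (g _)
        (fun b => f ((canon w).size b))) = _ := fun u => P.graft_sum_right _ _ _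
  simp only [hR]
  -- Partitions `t` of the set of blocks of `s` correspond to partitions `u` coarser than `s`.
  have hL : ∀ s : Setoid (Fin N), ∑ t : Setoid (Fin (canon s).card),
      P.graft (canon s) (P.graft (canon t) (h _) (fun i => g ((canon t).size i)))
        (fun b => f ((canon s).size b)) = ∑ u : Setoid (Fin N), if s ≤ u then
      P.graft (canon u) (h _) (fun i =>
        P.graft (canon (s.comap fun q => (canon u).entry ⟨i, q⟩)) (g _)
        (fun b => f ((canon (s.comap fun q => (canon u).entry ⟨i, q⟩)).size b))) else 0 := by
    intro s
    rw [← Finset.sum_filter]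
    have hs : ∀ x, s ((canon s).entry ⟨((canon s).entry.symm x).1, 0⟩) x := by
      intro x
      have h1 := (canon s).setoid_entry ⟨((canon s).entry.symm x).1, 0⟩ ((canon s).entry.symm x)
      rw [setoid_canon, Equiv.apply_symm_apply] at h1
      exact h1.2 rfl
    symm
    refine Finset.sum_bij' (fun u _ => u.comap fun b => (canon s).entry ⟨b, 0⟩)
      (fun t _ => t.comap fun x => ((canon s).entry.symm x).1) (fun _ _ => Finset.mem_univ _)
      ?_ ?_ ?_ ?_
    · intro t _
      simp only [Finset.mem_filter, Finset.mem_univ, true_and]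
      intro x y hxy
      rw [Setoid.comap_rel]
      rw [← setoid_canon s, setoid_apply] at hxy
      rw [hxy]
    · intro u hu
      simp only [Finset.mem_filter, Finset.mem_univ, true_and] at hu
      ext x y
      rw [Setoid.comap_rel, Setoid.comap_rel]
      exact ⟨fun h2 => u.trans (u.symm (hu (hs x))) (u.trans h2 (hu (hs y))),
        fun h2 => u.trans (hu (hs x)) (u.trans h2 (u.symm (hu (hs y))))⟩
    · intro t _
      ext b b'
      simp [Setoid.comap_rel]
    · intro u hu
      simp only [Finset.mem_filter, Finset.mem_univ, true_and] at hu
      exact (P.graft_canon_graft_canon hu _ rfl _ (fun _ => rfl) h g f).symm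
  simp only [hL]
  rw [Finset.sum_comm]
  refine Finset.sum_congr rfl fun u _ => ?_
  rw [← Finset.sum_filter]
  -- Partitions `s` finer than `u` correspond to families of partitions of the blocks of `u`.
  refine Finset.sum_bij' (fun s _ i => s.comap fun q => (canon u).entry ⟨i, q⟩)
    (fun w _ => (canon u).refinement w) (fun _ _ => Finset.mem_univ _) ?_ ?_ ?_ ?_
  · intro w _
    simp only [Finset.mem_filter, Finset.mem_univ, true_and]
    exact ((canon u).refinement_le w).trans_eq (setoid_canon u)
  · intro s hs
    simp only [Finset.mem_filter, Finset.mem_univ, true_and] at hs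
    have hs' := hs.trans_eq (setoid_canon u).symm
    ext x y
    obtain ⟨⟨i, a⟩, rfl⟩ := (canon u).entry.surjective x
    obtain ⟨⟨i', a'⟩, rfl⟩ := (canon u).entry.surjective y
    by_cases hi : i = i'
    · subst hi
      exact (canon u).refinement_entry _ i a a'
    · exact ⟨fun h2 => absurd (((canon u).setoid_entry _ _).1
        ((canon u).refinement_le _ h2)) hi,
        fun h2 => absurd (((canon u).setoid_entry _ _).1 (hs' h2)) hi⟩
  · intro w _
    funext i
    ext a a'
    exact (canon u).refinement_entry w i a a'
  · intro s _
    rfl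

end SymmetricOperad

/-! ### Size bounds and the two extreme partitions -/

namespace Decomposition

variable {n : ℕ+}

theorem size_le (D : Decomposition n) (b : Fin D.card) : D.size b ≤ n := by
  rw [← PNat.coe_le_coe, ← D.sum_size]
  exact Finset.single_le_sum (f := fun b => (D.size b : ℕ)) (fun _ _ => Nat.zero_le _)
    (Finset.mem_univ b)

theorem card_le (D : Decomposition n) : D.card ≤ n := by
  rw [← PNat.coe_le_coe, ← D.sum_size]
  calc (D.card : ℕ) = ∑ _b : Fin D.card, 1 := by simp
    _ ≤ _ := Finset.sum_le_sum fun b _ => (D.size b).pos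

theorem setoid_eq_bot_of_size (D : Decomposition n) (h : ∀ b, D.size b = 1) : D.setoid = ⊥ := by
  rw [eq_bot_iff]
  intro x y hxy
  obtain ⟨⟨b, a⟩, rfl⟩ := D.entry.surjective x
  obtain ⟨⟨b', a'⟩, rfl⟩ := D.entry.surjective y
  obtain rfl : b = b' := (D.setoid_entry _ _).1 hxy
  obtain rfl : a = a' := by
    have h1 := a.2
    have h2 := a'.2
    have h3 : (D.size b : ℕ) = 1 := by rw [h b, PNat.one_coe]
    apply Fin.ext
    omega
  rfl

theorem setoid_eq_bot_of_card (D : Decomposition n) (h : D.card = n) : D.setoid = ⊥ := by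
  apply D.setoid_eq_bot_of_size
  -- With `n` blocks, the sizes are at least `1` and sum to `n`, so each is `1`.
  have h1 : ∑ _b : Fin D.card, 1 = ∑ b, (D.size b : ℕ) := by
    rw [D.sum_size, Finset.sum_const, Finset.card_univ, Fintype.card_fin, smul_eq_mul, mul_one]
    exact congrArg _ h
  intro b
  apply PNat.coe_injective
  exact ((Finset.sum_eq_sum_iff_of_le fun b _ => (D.size b).pos).1 h1 b (Finset.mem_univ b)).symm

theorem card_canon_lt {s : Setoid (Fin n)} (hs : s ≠ ⊥) : (canon s).card < n :=
  lt_of_le_of_ne (card_le _) fun h => hs ((setoid_canon s).symm.trans (setoid_eq_bot_of_card _ h))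

theorem setoid_eq_top_of_card (D : Decomposition n) (h : D.card = 1) : D.setoid = ⊤ := by
  rw [eq_top_iff]
  intro x y _
  rw [setoid_apply]
  have h1 := (D.entry.symm x).1.2
  have h2 := (D.entry.symm y).1.2
  have h3 : (D.card : ℕ) = 1 := by rw [h, PNat.one_coe]
  apply Fin.ext
  omega

instance : Unique (Fin ((1 : ℕ+) : ℕ)) := inferInstanceAs (Unique (Fin 1))

variable (n) in
/-- The decomposition into singletons. -/
def discrete : Decomposition n := ⟨n, fun _ => 1, Equiv.sigmaUnique _ _⟩

variable (n) in
/-- The decomposition with one block. -/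
def indiscrete : Decomposition n := 
  ⟨1, fun _ => n, (Equiv.sigmaEquivProd _ _).trans (Equiv.uniqueProd _ _)⟩

theorem canon_bot : canon (⊥ : Setoid (Fin n)) = discrete n :=
  Canonical.canon_eq ⟨fun _ => Subsingleton.strictMono (α := Fin ((1 : ℕ+) : ℕ)) _,
    fun _ _ h => h⟩ ((discrete n).setoid_eq_bot_of_size fun _ => rfl)

theorem canon_top : canon (⊤ : Setoid (Fin n)) = indiscrete n :=
  Canonical.canon_eq ⟨fun _ _ _ h => h, Subsingleton.strictMono (α := Fin ((1 : ℕ+) : ℕ)) _⟩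
    ((indiscrete n).setoid_eq_top_of_card rfl)

theorem slot_discrete :
    (discrete n).entry.symm.trans (operadSlot (discrete n).sum_size) = 1 := by
  ext x
  obtain ⟨⟨b, a⟩, rfl⟩ := (discrete n).entry.surjective x
  rw [Equiv.trans_apply, Equiv.symm_apply_apply, operadSlot_val]
  have ha : (a : ℕ) = 0 := Nat.lt_one_iff.1 a.2
  have hc : (Finset.univ.filter fun i => i < b).card = (b : ℕ) := by
    rw [Finset.filter_gt_eq_Iio]
    exact Fin.card_Iio b
  simp only [ha, discrete, PNat.one_coe]
  rw [← Finset.sum_filter, Finset.sum_const, smul_eq_mul, mul_one]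
  exact hc

theorem slot_indiscrete :
    (indiscrete n).entry.symm.trans (operadSlot (indiscrete n).sum_size) = 1 := by
  ext x
  obtain ⟨⟨b, a⟩, rfl⟩ := (indiscrete n).entry.surjective x
  rw [Equiv.trans_apply, Equiv.symm_apply_apply, operadSlot_val, Finset.sum_eq_zero, zero_add]
  · rfl
  · intro i _
    rw [if_neg]
    have h1 : Subsingleton (Fin ((1 : ℕ+) : ℕ)) := inferInstance
    exact (h1.elim i b).not_lt

end Decomposition

/-! ### Unit, inverses, group structure and truncations -/

namespace SymmetricOperad

open Decomposition

variable {R : Type u} [CommRing R] (P : SymmetricOperad.{u, v} R)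

/-- The sequence `(id, 0, 0, …)`. -/
def oneSeq : ∀ n : ℕ+, P.obj n := Function.update (fun _ => 0) 1 P.id

@[simp] theorem oneSeq_one : P.oneSeq 1 = P.id := Function.update_self _ _ _

theorem oneSeq_of_ne {n : ℕ+} (h : n ≠ 1) : P.oneSeq n = 0 := Function.update_of_ne h _ _

theorem graft_canon_bot (g f : ∀ n : ℕ+, P.obj n) (hf : f 1 = P.id) (n : ℕ+) :
    P.graft (canon (⊥ : Setoid (Fin n))) (g _) (fun b => f ((canon ⊥).size b)) = g n := by
  rw [canon_bot, graft, slot_discrete, P.act_one]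
  have h := P.comp_id (discrete n).sum_size (g n)
  rw [← hf] at h
  exact h

theorem graft_canon_top (g f : ∀ n : ℕ+, P.obj n) (hg : g 1 = P.id) (n : ℕ+) :
    P.graft (canon (⊤ : Setoid (Fin n))) (g _) (fun b => f ((canon ⊤).size b)) = f n := by
  rw [canon_top, graft, slot_indiscrete, P.act_one]
  have h := P.id_comp (indiscrete n).sum_size (f n)
  rw [← hg] at h
  exact h

theorem oneSeq_seqProd (f : ∀ n : ℕ+, P.obj n) : P.seqProd P.oneSeq f = f := by
  funext n
  rw [seqProd_eq_sum, Finset.sum_eq_single_of_mem ⊤ (Finset.mem_univ _)]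
  · exact P.graft_canon_top P.oneSeq f P.oneSeq_one n
  · intro s _ hs
    rw [P.oneSeq_of_ne fun h => hs ((setoid_canon s).symm.trans (setoid_eq_top_of_card _ h))]
    simp [graft]

open scoped Classical in
-- Isolates the only term containing `g n`: by `card_canon_lt` the remaining sum involves `g` in
-- smaller arities, which makes the product solvable for `g`.
theorem seqProd_eq_add (g f : ∀ n : ℕ+, P.obj n) (hf : f 1 = P.id) (n : ℕ+) :
    P.seqProd g f n = g n + ∑ s : {s : Setoid (Fin n) // s ≠ ⊥},
      P.graft (canon s.1) (g _) (fun b => f ((canon s.1).size b)) := by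
  rw [seqProd_eq_sum, Fintype.sum_eq_add_sum_subtype_ne _ ⊥, P.graft_canon_bot g f hf]

open scoped Classical in
theorem exists_seqProd_eq_oneSeq (f : ∀ n : ℕ+, P.obj n) (hf : f 1 = P.id) :
    ∃ g : ∀ n : ℕ+, P.obj n, g 1 = P.id ∧ P.seqProd g f = P.oneSeq := by
  -- The equation `(g • f) n = oneSeq n` solved for `g n`, given `g` in smaller arities.
  let F : ∀ n : ℕ+, (∀ k : ℕ+, k < n → P.obj k) → P.obj n := fun n G =>
    P.oneSeq n - ∑ s : {s : Setoid (Fin n) // s ≠ ⊥},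
      P.graft (canon s.1) (G _ (card_canon_lt s.2)) (fun b => f ((canon s.1).size b))
  let g : ∀ n : ℕ+, P.obj n := wellFounded_lt.fix F
  have hg : ∀ n, g n = F n fun k _ => g k := wellFounded_lt.fix_eq F
  refine ⟨g, ?_, ?_⟩
  · rw [hg]
    have : IsEmpty {s : Setoid (Fin (1 : ℕ+)) // s ≠ ⊥} :=
      ⟨fun s => (card_canon_lt s.2).not_ge one_le⟩
    exact (congrArg _ (Fintype.sum_empty _)).trans ((sub_zero _).trans P.oneSeq_one)
  · funext n
    rw [P.seqProd_eq_add g f hf, hg n]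
    exact sub_add_cancel _ _

theorem seqProd_congr {m : ℕ} {g g' f f' : ∀ n : ℕ+, P.obj n}
    (hg : ∀ n : ℕ+, (n : ℕ) ≤ m → g n = g' n) (hf : ∀ n : ℕ+, (n : ℕ) ≤ m → f n = f' n)
    (n : ℕ+) (hn : (n : ℕ) ≤ m) : P.seqProd g f n = P.seqProd g' f' n := by
  rw [seqProd_eq_sum, seqProd_eq_sum]
  refine Finset.sum_congr rfl fun s _ => ?_
  rw [hg _ ((PNat.coe_le_coe _ _ |>.2 (card_le _)).trans hn)]
  congr 1
  funext b
  exact hf _ ((PNat.coe_le_coe _ _ |>.2 (size_le _ b)).trans hn)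

noncomputable instance : Group P.H :=
  letI : Mul P.H := ⟨P.prod⟩
  letI : One P.H := ⟨⟨P.oneSeq, P.oneSeq_one⟩⟩
  letI : Inv P.H := ⟨fun f => ⟨(P.exists_seqProd_eq_oneSeq f.1 f.2).choose,
    (P.exists_seqProd_eq_oneSeq f.1 f.2).choose_spec.1⟩⟩
  -- Associativity, a left unit and left inverses suffice for a group.
  Group.ofLeftAxioms (fun h g f => Subtype.ext (P.seqProd_assoc h.1 g.1 f.1))
    (fun f => Subtype.ext (P.oneSeq_seqProd f.1))
    (fun f => Subtype.ext (P.exists_seqProd_eq_oneSeq f.1 f.2).choose_spec.2)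

/-- The congruence identifying sequences which agree up to arity `m`. -/
def truncationCon (m : ℕ) : Con P.H where
  r f g := ∀ n : ℕ+, (n : ℕ) ≤ m → f.1 n = g.1 n
  iseqv := ⟨fun _ _ _ => rfl, fun h n hn => (h n hn).symm,
    fun h h' n hn => (h n hn).trans (h' n hn)⟩
  mul' h h' := P.seqProd_congr h h'

theorem coe_ker_truncationCon (m : ℕ) :
    ((P.truncationCon m).mk'.ker : Set P.H) = P.Hm m := by
  ext f
  have h1 : f ∈ ((P.truncationCon m).mk'.ker : Set P.H) ↔ P.truncationCon m f 1 :=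
    (P.truncationCon m).eq
  rw [h1]
  constructor
  · intro h n h2 hm
    refine (h n hm).trans (P.oneSeq_of_ne ?_)
    rintro rfl
    exact absurd h2 (by decide)
  · intro h n hm
    by_cases hn : n = 1
    · subst hn
      exact f.2.trans P.oneSeq_one.symm
    · have h2 : 2 ≤ (n : ℕ) := by
        have h3 : (n : ℕ) ≠ 1 := fun h4 => hn (PNat.coe_injective h4)
        have h5 := n.pos
        omega
      exact (h n h2 hm).trans (P.oneSeq_of_ne hn).symm

end SymmetricOperad

theorem mainTheorem6 {R : Type u} [CommRing R] (P : SymmetricOperad.{u, v} R) :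
    ∃ _ : Group P.H, (∀ g f : P.H, g * f = P.prod g f) ∧
      ∀ m : ℕ, 0 < m → ∃ N : Subgroup P.H, (N : Set P.H) = P.Hm m ∧ N.Normal := by
  exact ⟨inferInstance, fun _ _ => rfl, fun m _ =>
    ⟨(P.truncationCon m).mk'.ker, P.coe_ker_truncationCon m, inferInstance⟩⟩
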